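/- Let $X$ be a real Banach space with dual $X^*$ and bidual $X^{**}$, and regard $X$ as a subspace of $X^{**}$. For a multivalued operator $T:X\rightrightarrows X^*$, identified with its graph in $X\times X^*$, let $\widetilde T$ be the set of all $(x^{**},x^*)\in X^{**}\times X^*$ such that $\langle x^{**}-y,\,x^*-y^*\rangle\ge 0$ for every $(y,y^*)\in T$. A maximal monotone operator $T$ is of type (D) if every $(x^{**},x^*)\in\widetilde T$ is the limit, in the weak$^*\times$strong topology of $X^{**}\times X^*$, of a bounded net contained in $T$. For $\varepsilon>0$ let $J_\varepsilon:X\rightrightarrows X^*$ be the $\varepsilon$-subdifferential of $\tfrac12\|\cdot\|^2$, that is, $$J_\varepsilon(u)=\big\{w^*\in X^*:\ \tfrac12\|y\|^2\ge \tfrac12\|u\|^2+\langle y-u,w^*\rangle-\varepsilon\ \text{ for all } y\in X\big\}.$$ Let $(T_n)_{n\in\mathbb N}$ be a sequence of maximal monotone operators $T_n:X\rightrightarrows X^*$ of type (D), let $(\varepsilon_n)_n$ be a sequence of positive numbers converging to $0$, and let $$\liminf T_n=\big\{(x,x^*)\in X\times X^*:\ \exists\,(y_n,y_n^*)\in T_n\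 (n\in\mathbb N)\text{ with } y_n\to x \text{ and } y_n^*\to x^* \text{ in norm}\big\}.$$ Let $(x,x^*)\in X\times X^*$. Then for every $n$ the inclusion $$x^*\in T_n(x_n)+J_{\varepsilon_n}(x_n-x)$$ has a solution $x_n\in X$, and for every sequence $(x_n)_n$ such that $x_n$ is a solution of this inclusion for each $n$, $$(x,x^*)\in\liminf T_n\quad\Longleftrightarrow\quad \lim_{n\to\infty}\|x_n-x\|=0 .$$ -/

import Mathlib

open Filter Topology
open scoped Pointwise

section MonotoneOperators

universe u

variable {X : Type u} [NormedAddCommGroup X] [NormedSpace ℝ X]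

/-- A multivalued operator `T : X ⇉ X*` is a map `X → Set X*`; operators are ordered by inclusion of
their graphs. `T` is monotone if `⟨x - y, x* - y*⟩ ≥ 0` for all `(x, x*)`, `(y, y*)` in `T`. -/
def IsMonotoneOperator (T : X → Set (StrongDual ℝ X)) : Prop :=
  ∀ x y : X, ∀ xs ∈ T x, ∀ ys ∈ T y, 0 ≤ (xs - ys) (x - y)

/-- Maximality with respect to inclusion of graphs. -/
def IsMaximalMonotone (T : X → Set (StrongDual ℝ X)) : Prop :=
  Maximal IsMonotoneOperator T

/-- The extension `T~ : X** ⇉ X*` of `T`: all `(x**, x*)` that are monotonically related to every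
point of `T`, where `X` is seen as a subspace of `X**` through the canonical injection. -/
def bidualExtension (T : X → Set (StrongDual ℝ X))
    (xss : StrongDual ℝ (StrongDual ℝ X)) : Set (StrongDual ℝ X) :=
  {xs | ∀ y : X, ∀ ys ∈ T y, 0 ≤ (xss - NormedSpace.inclusionInDoubleDual ℝ X y) (xs - ys)}

/-- Gossez' type (D): every point `(x**, x*)` of `T~` is the limit, in the weak* × strong topology
of `X** × X*`, of a bounded net in the graph of `T`. Nets are indexed by non-empty directed
preorders in the universe of `X`, which is enough because neighbourhoods in `X** × X*`
and points of `X × X*` live there. -/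
def IsTypeD (T : X → Set (StrongDual ℝ X)) : Prop :=
  ∀ (xss : StrongDual ℝ (StrongDual ℝ X)) (xs : StrongDual ℝ X), xs ∈ bidualExtension T xss →
    ∃ (ι : Type u) (_ : Preorder ι) (_ : IsDirectedOrder ι) (_ : Nonempty ι)
      (y : ι → X) (ys : ι → StrongDual ℝ X),
      (∀ a, ys a ∈ T (y a)) ∧
      Bornology.IsBounded (Set.range fun a => (y a, ys a)) ∧
      Tendsto (fun a => StrongDual.toWeakDual (NormedSpace.inclusionInDoubleDual ℝ X (y a)))
        atTop (𝓝 (StrongDual.toWeakDual xss)) ∧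
      Tendsto ys atTop (𝓝 xs)

/-- The `ε`-subdifferential of a real-valued function `f` on `X`. -/
def epsSubdifferential (f : X → ℝ) (ε : ℝ) (x : X) : Set (StrongDual ℝ X) :=
  {xs | ∀ y : X, f x + xs (y - x) - ε ≤ f y}

/-- `J_ε`, the `ε`-subdifferential of `(1/2) ‖·‖ ^ 2`. -/
noncomputable def epsDualityMap (ε : ℝ) : X → Set (StrongDual ℝ X) :=
  epsSubdifferential (fun x => (1 / 2 : ℝ) * ‖x‖ ^ 2) ε

/-- The sequential lower limit of `(T n)`, for the strong × strong topology of `X × X*`. -/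
def seqLowerLimit (T : ℕ → X → Set (StrongDual ℝ X)) (x : X) : Set (StrongDual ℝ X) :=
  {xs | ∃ (y : ℕ → X) (ys : ℕ → StrongDual ℝ X), (∀ n, ys n ∈ T n (y n)) ∧
    Tendsto (fun n => (y n, ys n)) atTop (𝓝 (x, xs))}

end MonotoneOperators

/-! By Fenchel–Young, the inclusion asks for `(z, zs)` in `T n` with `⟨z - x, zs - xs⟩ + ½‖z - x‖² +
½‖zs - xs‖² ≤ ε n`. This quantity is nonnegative on all of `X × X*`, so solvability says that its
infimum over the graph is `0`.

Type (D) yields the condition of negative infimum. Hahn–Banach then makes the Fitzpatrick function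
plus `halfSqNorm` (recentred at `(x, xs)`) nearly nonpositive at some point, which need not lie in
the graph (`HasNegativeInfimum.exists_forall_le`). A Brøndsted–Rockafellar iteration moves this
point into the graph at small cost (`HasNegativeInfimum.exists_mem_norm_sub_le`).

For the equivalence, monotonicity against points of `T n` converging to `(x, xs)` bounds `‖z n -
x‖`; conversely the inequality gives `½(‖zs - xs‖ - ‖z - x‖)² ≤ ε n`, so `z n → x` forces `zs n →
xs`. -/

section NegativeInfimum

variable {X : Type*} [NormedAddCommGroup X] [NormedSpace ℝ X]

/-- Half the sum of the squared norms of the components of a point of `X × X*`. -/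
noncomputable def halfSqNorm (p : X × StrongDual ℝ X) : ℝ :=
  1 / 2 * ‖p.1‖ ^ 2 + 1 / 2 * ‖p.2‖ ^ 2

/-- Simons' condition of negative infimum: no point of `X** × X*` is uniformly strictly monotonically
related to `G`. -/
def HasNegativeInfimum (G : Set (X × StrongDual ℝ X)) : Prop :=
  ∀ (zss : StrongDual ℝ (StrongDual ℝ X)) (zs : StrongDual ℝ X) (η : ℝ), 0 < η →
    ∃ t ∈ G, (zss - NormedSpace.inclusionInDoubleDual ℝ X t.1) (zs - t.2) < η

lemma neg_mul_norm_le_apply (f : StrongDual ℝ X) (x : X) : -(‖f‖ * ‖x‖) ≤ f x := by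
  have h := f.le_opNorm x
  rw [Real.norm_eq_abs] at h
  exact (abs_le.1 h).1

lemma apply_le_mul_norm (f : StrongDual ℝ X) (x : X) : f x ≤ ‖f‖ * ‖x‖ := by
  have h := f.le_opNorm x
  rw [Real.norm_eq_abs] at h
  exact (abs_le.1 h).2

lemma apply_add_halfSqNorm_nonneg (p : X × StrongDual ℝ X) : 0 ≤ p.2 p.1 + halfSqNorm p := by
  have := neg_mul_norm_le_apply p.2 p.1
  unfold halfSqNorm
  nlinarith [sq_nonneg (‖p.1‖ - ‖p.2‖)]

/-- The conjugate of `(1/2) ‖·‖ ^ 2` is `(1/2) ‖·‖ ^ 2`. -/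
lemma exists_half_sq_norm_add_le (f : StrongDual ℝ X) {δ : ℝ} (hδ : 0 < δ) :
    ∃ u : X, f u + 1 / 2 * ‖u‖ ^ 2 + 1 / 2 * ‖f‖ ^ 2 ≤ δ := by
  rcases (norm_nonneg f).eq_or_lt with h0 | hpos
  · refine ⟨0, ?_⟩
    rw [← h0]; simpa using hδ.le
  obtain ⟨v, hv1, hv⟩ := f.exists_lt_apply_of_lt_opNorm
    (show ‖f‖ - δ / ‖f‖ < ‖f‖ by have := div_pos hδ hpos; linarith)
  have key : ∃ w : X, ‖w‖ < 1 ∧ f w < -(‖f‖ - δ / ‖f‖) := by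
    rw [Real.norm_eq_abs] at hv
    rcases lt_abs.1 hv with h | h
    · exact ⟨-v, by simpa using hv1, by rw [map_neg]; linarith⟩
    · exact ⟨v, hv1, by linarith⟩
  obtain ⟨w, hw1, hw⟩ := key
  refine ⟨‖f‖ • w, ?_⟩
  have h1 : ‖f‖ * f w ≤ ‖f‖ * -(‖f‖ - δ / ‖f‖) := mul_le_mul_of_nonneg_left hw.le hpos.le
  have h2 : ‖f‖ * (δ / ‖f‖) = δ := mul_div_cancel₀ δ hpos.ne'
  have h3 : (‖f‖ * ‖w‖) ^ 2 ≤ ‖f‖ ^ 2 := by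
    have : ‖f‖ * ‖w‖ ≤ ‖f‖ := mul_le_of_le_one_right hpos.le hw1.le
    gcongr
  rw [norm_smul, norm_norm, map_smul, smul_eq_mul]
  nlinarith

/-- The Fenchel–Young equality up to `ε`, as half the squared norm is conjugate to half the squared
dual norm. -/
lemma mem_epsDualityMap_iff {ε : ℝ} {u : X} {w : StrongDual ℝ X} :
    w ∈ epsDualityMap ε u ↔ 1 / 2 * ‖u‖ ^ 2 + 1 / 2 * ‖w‖ ^ 2 ≤ w u + ε := by
  simp only [epsDualityMap, epsSubdifferential, Set.mem_ofPred_eq, map_sub]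
  constructor
  · intro h
    refine le_of_forall_pos_le_add fun δ hδ => ?_
    obtain ⟨y, hy⟩ := exists_half_sq_norm_add_le (-w) hδ
    have := h y
    simp only [norm_neg, neg_apply] at hy
    linarith
  · intro h y
    have := apply_le_mul_norm w y
    nlinarith [sq_nonneg (‖w‖ - ‖y‖)]

/-- Fenchel duality for the Fitzpatrick function of `G` and `halfSqNorm`. -/
lemma HasNegativeInfimum.exists_fitzpatrick_add_le {G : Set (X × StrongDual ℝ X)}
    (hG : HasNegativeInfimum G) (hmono : ∀ s ∈ G, ∀ t ∈ G, 0 ≤ (s.2 - t.2) (s.1 - t.1))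
    {η : ℝ} (hη : 0 < η) :
    ∃ q : X × StrongDual ℝ X, ∀ t ∈ G, halfSqNorm q + (q.2 t.1 + t.2 q.1 - t.2 t.1) ≤ η := by
  by_contra! hcon
  -- The open strict hypograph of `η - halfSqNorm` and the epigraph of the Fitzpatrick function are
  -- disjoint convex sets.
  let A : Set ((X × StrongDual ℝ X) × ℝ) := {e | e.2 < η - halfSqNorm e.1}
  let E : Set ((X × StrongDual ℝ X) × ℝ) := {e | ∀ t ∈ G, e.1.2 t.1 + t.2 e.1.1 - t.2 t.1 ≤ e.2}
  have hcont : Continuous (halfSqNorm : X × StrongDual ℝ X → ℝ) := by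
    unfold halfSqNorm; fun_prop
  have hconv : ConvexOn ℝ Set.univ (halfSqNorm : X × StrongDual ℝ X → ℝ) := by
    have hsq {V : Type _} [NormedAddCommGroup V] [NormedSpace ℝ V] :
        ConvexOn ℝ Set.univ (fun v : V => 1 / 2 * ‖v‖ ^ 2) := by
      have := (convexOn_univ_norm (E := V)).pow (fun _ _ => norm_nonneg _) 2
      exact this.smul (by norm_num : (0 : ℝ) ≤ 1 / 2)
    have h1 := (hsq (V := X)).comp_linearMap (LinearMap.fst ℝ X (StrongDual ℝ X))
    have h2 := (hsq (V := StrongDual ℝ X)).comp_linearMap (LinearMap.snd ℝ X (StrongDual ℝ X))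
    exact h1.add h2
  have hAo : IsOpen A := isOpen_lt (by fun_prop) (by fun_prop)
  have hAc : Convex ℝ A := by
    intro e he e' he' a b ha hb hab
    have h := hconv.2 (Set.mem_univ e.1) (Set.mem_univ e'.1) ha hb hab
    simp only [A, Set.mem_ofPred_eq, Prod.snd_add, Prod.smul_snd, Prod.fst_add, Prod.smul_fst,
      smul_eq_mul] at he he' h ⊢
    rcases ha.eq_or_lt with rfl | ha'
    · obtain rfl : b = 1 := by linarith
      linarith
    · obtain rfl : a = 1 - b := by linarith
      nlinarith [mul_lt_mul_of_pos_left he ha', mul_le_mul_of_nonneg_left he'.le hb]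
  have hEc : Convex ℝ E := by
    intro e he e' he' a b ha hb hab t ht
    have h1 := mul_le_mul_of_nonneg_left (he t ht) ha
    have h2 := mul_le_mul_of_nonneg_left (he' t ht) hb
    simp only [Prod.snd_add, Prod.smul_snd, Prod.fst_add, Prod.smul_fst, smul_eq_mul, map_add,
      map_smul, add_apply, smul_apply]
    obtain rfl : a = 1 - b := by linarith
    linarith
  have hdisj : Disjoint A E := by
    refine Set.disjoint_left.2 fun e he he' => ?_
    obtain ⟨t, ht, h⟩ := hcon e.1
    have h1 := he' t ht
    simp only [A, Set.mem_ofPred_eq] at he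
    linarith
  have hGE : ∀ s ∈ G, (s, s.2 s.1) ∈ E := by
    intro s hs t ht
    have := hmono s hs t ht
    simp only [map_sub, sub_apply] at this ⊢
    linarith
  obtain ⟨f, u, hfA, hfE⟩ := geometric_hahn_banach_open hAc hAo hEc hdisj
  let f₁ : StrongDual ℝ X := f.comp ((ContinuousLinearMap.inl ℝ _ ℝ).comp
    (ContinuousLinearMap.inl ℝ X (StrongDual ℝ X)))
  let f₂ : StrongDual ℝ (StrongDual ℝ X) := f.comp ((ContinuousLinearMap.inl ℝ _ ℝ).comp
    (ContinuousLinearMap.inr ℝ X (StrongDual ℝ X)))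
  let s : ℝ := f (0, 1)
  have hf : ∀ (y : X) (ys : StrongDual ℝ X) (c : ℝ), f ((y, ys), c) = f₁ y + f₂ ys + s * c := by
    intro y ys c
    have : (((y, ys), c) : (X × StrongDual ℝ X) × ℝ)
        = ((y, 0), 0) + ((0, ys), 0) + c • ((0, 1) : (X × StrongDual ℝ X) × ℝ) := by
      simp
    rw [this, map_add, map_add, map_smul, smul_eq_mul, mul_comm]
    rfl
  obtain ⟨t₀, ht₀, -⟩ := hG 0 0 1 one_pos
  -- The separating hyperplane is not vertical: both sets have points above `t₀`, those of `A`
  -- lower.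
  have hs : 0 < s := by
    have h1 := hfA (t₀, min (t₀.2 t₀.1) (η - halfSqNorm t₀) - 1) (by
      have := min_le_right (t₀.2 t₀.1) (η - halfSqNorm t₀)
      simp only [A, Set.mem_ofPred_eq]; linarith)
    have h2 := hfE _ (hGE t₀ ht₀)
    have h3 := min_le_left (t₀.2 t₀.1) (η - halfSqNorm t₀)
    rw [hf t₀.1 t₀.2] at h1 h2
    by_contra hs
    nlinarith
  let zs : StrongDual ℝ X := -(s⁻¹ • f₁)
  let zss : StrongDual ℝ (StrongDual ℝ X) := -(s⁻¹ • f₂)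
  have hzs : ∀ y, f₁ y = -(s * zs y) := by
    intro y
    simp only [zs, neg_apply, smul_apply, smul_eq_mul]
    field_simp
  have hzss : ∀ ys, f₂ ys = -(s * zss ys) := by
    intro y
    simp only [zss, neg_apply, smul_apply, smul_eq_mul]
    field_simp
  -- Testing at `(v, zs)` turns the cross term into `zss zs`, so the separation says `η / 2 < ⟨zss -
  -- t.1, zs - t.2⟩`.
  obtain ⟨v, hv⟩ := exists_half_sq_norm_add_le zs (show 0 < η / 4 by linarith)
  obtain ⟨t, ht, hlt⟩ := hG zss zs (η / 2) (by linarith)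
  have h1 := (hfA ((v, zs), η - halfSqNorm (v, zs) - η / 4) (by
    simp only [A, Set.mem_ofPred_eq]; linarith)).trans_le (hfE _ (hGE t ht))
  rw [hf, hf t.1 t.2, hzs, hzss, hzs, hzss] at h1
  have h2 : -zs v - zss zs + (η - halfSqNorm (v, zs) - η / 4)
      < -zs t.1 - zss t.2 + t.2 t.1 := by
    refine lt_of_mul_lt_mul_left ?_ hs.le
    linarith
  simp only [halfSqNorm] at h2
  simp only [map_sub, sub_apply, NormedSpace.dual_def] at hlt
  linarith

/-- The translate of `HasNegativeInfimum.exists_fitzpatrick_add_le` by `p₀`. -/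
lemma HasNegativeInfimum.exists_forall_le {G : Set (X × StrongDual ℝ X)}
    (hG : HasNegativeInfimum G) (hmono : ∀ s ∈ G, ∀ t ∈ G, 0 ≤ (s.2 - t.2) (s.1 - t.1))
    (p₀ : X × StrongDual ℝ X) {η : ℝ} (hη : 0 < η) :
    ∃ p : X × StrongDual ℝ X, ∀ t ∈ G,
      (p - p₀).2 (p - p₀).1 + halfSqNorm (p - p₀) - (p - t).2 (p - t).1 ≤ η := by
  have hG' : HasNegativeInfimum ((fun t => t - p₀) '' G) := by
    intro zss zs δ hδ
    obtain ⟨t, ht, h⟩ := hG (zss + NormedSpace.inclusionInDoubleDual ℝ X p₀.1) (zs + p₀.2) δ hδ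
    refine ⟨t - p₀, ⟨t, ht, rfl⟩, ?_⟩
    convert h using 2
    · rw [Prod.fst_sub, map_sub]; abel
    · rw [Prod.snd_sub]; abel
  obtain ⟨q, hq⟩ := hG'.exists_fitzpatrick_add_le (by
    rintro _ ⟨s, hs, rfl⟩ _ ⟨t, ht, rfl⟩
    simpa using hmono s hs t ht) hη
  refine ⟨q + p₀, fun t ht => ?_⟩
  have h := hq _ ⟨t, ht, rfl⟩
  rw [add_sub_cancel_right]
  simp only [Prod.snd_sub, Prod.fst_sub, Prod.snd_add, Prod.fst_add, map_sub, map_add,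
    sub_apply, add_apply] at h ⊢
  linarith

lemma HasNegativeInfimum.exists_apply_sub_lt {G : Set (X × StrongDual ℝ X)}
    (hG : HasNegativeInfimum G) (p : X × StrongDual ℝ X) {δ : ℝ} (hδ : 0 < δ) :
    ∃ t ∈ G, (p - t).2 (p - t).1 < δ := by
  obtain ⟨t, ht, h⟩ := hG (NormedSpace.inclusionInDoubleDual ℝ X p.1) p.2 δ hδ
  refine ⟨t, ht, ?_⟩
  simp only [sub_apply, map_sub, NormedSpace.dual_def, Prod.snd_sub, Prod.fst_sub] at h ⊢
  linarith

/-- Approximate minimizers are close to the points at which the Fitzpatrick function is close to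
the duality product. -/
lemma HasNegativeInfimum.halfSqNorm_sub_le {G : Set (X × StrongDual ℝ X)}
    (hG : HasNegativeInfimum G) {p₀ p r : X × StrongDual ℝ X} {η c : ℝ}
    (hp : ∀ t ∈ G, (p - p₀).2 (p - p₀).1 + halfSqNorm (p - p₀) - (p - t).2 (p - t).1 ≤ η)
    (hr : ∀ t ∈ G, -c ≤ (r - t).2 (r - t).1) :
    halfSqNorm (p - p₀) ≤ 4 * (η + c + (r - p₀).2 (r - p₀).1) + 6 * halfSqNorm (r - p₀) := by
  refine le_of_forall_pos_le_add fun δ hδ => ?_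
  -- The duality product at a midpoint is the mean of the two values minus a quarter of its value at
  -- the difference. The coefficient `3 / 8 < 1 / 2` below lets `halfSqNorm (p - p₀)` be absorbed.
  obtain ⟨t, ht, hlt⟩ := hG.exists_apply_sub_lt ((1 / 2 : ℝ) • (p + r)) (show 0 < δ / 8 by linarith)
  have h1 := hp t ht
  have h2 := hr t ht
  have h3 := apply_add_halfSqNorm_nonneg ((1 / 2 : ℝ) • ((p - p₀) + (r - p₀)))
  have h4 : halfSqNorm ((1 / 2 : ℝ) • ((p - p₀) + (r - p₀)))
      ≤ 3 / 8 * halfSqNorm (p - p₀) + 3 / 4 * halfSqNorm (r - p₀) := by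
    have key {V : Type _} [NormedAddCommGroup V] [NormedSpace ℝ V] (a b : V) :
        ‖(1 / 2 : ℝ) • (a + b)‖ ^ 2 ≤ 3 / 8 * ‖a‖ ^ 2 + 3 / 4 * ‖b‖ ^ 2 := by
      have h := norm_add_le a b
      have h' : ‖a + b‖ ^ 2 ≤ (‖a‖ + ‖b‖) ^ 2 := by gcongr
      rw [norm_smul, mul_pow]
      norm_num
      nlinarith [sq_nonneg (‖a‖ - 2 * ‖b‖)]
    have k1 := key (p - p₀).1 (r - p₀).1
    have k2 := key (p - p₀).2 (r - p₀).2
    simp only [halfSqNorm, Prod.smul_fst, Prod.smul_snd, Prod.fst_add, Prod.snd_add]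
    linarith
  generalize halfSqNorm ((1 / 2 : ℝ) • ((p - p₀) + (r - p₀))) = A at *
  generalize halfSqNorm (p - p₀) = B at *
  generalize halfSqNorm (r - p₀) = C at *
  simp only [Prod.snd_sub, Prod.fst_sub, Prod.snd_add, Prod.fst_add, Prod.smul_fst, Prod.smul_snd,
    map_sub, map_add, map_smul, sub_apply, add_apply,
    smul_apply, smul_eq_mul] at *
  linarith

lemma norm_sq_le_two_mul_halfSqNorm (p : X × StrongDual ℝ X) : ‖p‖ ^ 2 ≤ 2 * halfSqNorm p := by
  unfold halfSqNorm
  rw [Prod.norm_def]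
  rcases max_choice ‖p.1‖ ‖p.2‖ with h | h <;> rw [h] <;>
    nlinarith [sq_nonneg ‖p.1‖, sq_nonneg ‖p.2‖]

/-- The Brøndsted–Rockafellar property: a point at which the Fitzpatrick function exceeds the duality
product by at most `σ ^ 2` is within `8 * σ` of the graph. -/
lemma HasNegativeInfimum.exists_mem_norm_sub_le [CompleteSpace X] {G : Set (X × StrongDual ℝ X)}
    (hG : HasNegativeInfimum G) (hmono : ∀ s ∈ G, ∀ t ∈ G, 0 ≤ (s.2 - t.2) (s.1 - t.1))
    (hmax : ∀ p : X × StrongDual ℝ X, (∀ t ∈ G, 0 ≤ (p - t).2 (p - t).1) → p ∈ G)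
    {p : X × StrongDual ℝ X} {σ : ℝ} (hσ : 0 < σ)
    (hp : ∀ t ∈ G, -σ ^ 2 ≤ (p - t).2 (p - t).1) :
    ∃ q ∈ G, ‖q - p‖ ≤ 8 * σ := by
  -- Recentring at the current point quarters the allowed excess; the squared displacement is at
  -- most `2 · 4 · (1 + 1/4) = 10 ≤ 16` times the old excess. The steps `4σ/2^k` sum to `8σ`.
  have step : ∀ (k : ℕ) (r : {r : X × StrongDual ℝ X //
      ∀ t ∈ G, -(σ * (1 / 2) ^ k) ^ 2 ≤ (r - t).2 (r - t).1}),
      ∃ q : {q : X × StrongDual ℝ X //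
        ∀ t ∈ G, -(σ * (1 / 2) ^ (k + 1)) ^ 2 ≤ (q - t).2 (q - t).1},
        dist r.1 q.1 ≤ 4 * σ * (1 / 2) ^ k := by
    rintro k ⟨r, hr⟩
    obtain ⟨q, hq⟩ := hG.exists_forall_le hmono r
      (show 0 < (σ * (1 / 2) ^ (k + 1)) ^ 2 by positivity)
    refine ⟨⟨q, fun t ht => ?_⟩, ?_⟩
    · have := hq t ht
      have := apply_add_halfSqNorm_nonneg (q - r)
      linarith
    · have h1 := hG.halfSqNorm_sub_le hq hr
      have h2 := norm_sq_le_two_mul_halfSqNorm (q - r)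
      have h3 : halfSqNorm (r - r) = 0 := by simp [halfSqNorm]
      have h4 : (r - r).2 (r - r).1 = 0 := by simp
      rw [h3, h4] at h1
      rw [dist_comm, dist_eq_norm]
      refine le_of_sq_le_sq ?_ (by positivity)
      have h5 : (σ * (1 / 2) ^ (k + 1)) ^ 2 = (σ * (1 / 2) ^ k) ^ 2 / 4 := by ring
      have h6 : (4 * σ * (1 / 2) ^ k) ^ 2 = 16 * (σ * (1 / 2) ^ k) ^ 2 := by ring
      have h7 := sq_nonneg (σ * (1 / 2) ^ k)
      rw [h6]
      rw [h5] at h1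
      linarith
  choose F hF using step
  let P : ∀ k : ℕ, {r : X × StrongDual ℝ X //
      ∀ t ∈ G, -(σ * (1 / 2) ^ k) ^ 2 ≤ (r - t).2 (r - t).1} :=
    Nat.rec ⟨p, by simpa using hp⟩ F
  have hdist : ∀ k, dist (P k).1 (P (k + 1)).1 ≤ 4 * σ * (1 / 2) ^ k := fun k => hF k (P k)
  obtain ⟨q, hq⟩ := cauchySeq_tendsto_of_complete
    (cauchySeq_of_le_geometric (1 / 2) (4 * σ) (by norm_num) hdist)
  have hle := dist_le_of_le_geometric_of_tendsto₀ (1 / 2) (4 * σ) (by norm_num) hdist hq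
  refine ⟨q, hmax q fun t ht => ?_, ?_⟩
  · have h1 : Tendsto (fun k => ((P k).1 - t).2 ((P k).1 - t).1) atTop
        (𝓝 ((q - t).2 (q - t).1)) := by
      have h := hq.sub_const t
      exact ((isBoundedBilinearMap_apply (𝕜 := ℝ) (E := X) (F := ℝ)).continuous.tendsto
        ((q - t).2, (q - t).1)).comp
          (((continuous_snd.tendsto _).comp h).prodMk_nhds ((continuous_fst.tendsto _).comp h))
    have h2 : Tendsto (fun k : ℕ => -(σ * (1 / 2 : ℝ) ^ k) ^ 2) atTop (𝓝 0) := by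
      have := (tendsto_pow_atTop_nhds_zero_of_lt_one (r := (1 / 2 : ℝ)) (by norm_num)
        (by norm_num)).const_mul σ
      simpa using (this.pow 2).neg
    exact le_of_tendsto_of_tendsto' h2 h1 fun k => (P k).2 t ht
  · rw [dist_comm, dist_eq_norm] at hle
    refine hle.trans (le_of_eq ?_)
    ring

/-- For a maximal monotone graph with negative infimum, `T + J_ε (· - x)` is surjective. -/
lemma HasNegativeInfimum.exists_mem_apply_add_halfSqNorm_le [CompleteSpace X]
    {G : Set (X × StrongDual ℝ X)}
    (hG : HasNegativeInfimum G) (hmono : ∀ s ∈ G, ∀ t ∈ G, 0 ≤ (s.2 - t.2) (s.1 - t.1))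
    (hmax : ∀ p : X × StrongDual ℝ X, (∀ t ∈ G, 0 ≤ (p - t).2 (p - t).1) → p ∈ G)
    (p₀ : X × StrongDual ℝ X) {ε : ℝ} (hε : 0 < ε) :
    ∃ q ∈ G, (q - p₀).2 (q - p₀).1 + halfSqNorm (q - p₀) ≤ ε := by
  obtain ⟨t₀, ht₀, -⟩ := hG 0 0 1 one_pos
  -- Comparison with `t₀ ∈ G` bounds `‖p - p₀‖` by an `N` chosen before `σ`.
  obtain ⟨N, hN0, hN⟩ : ∃ N : ℝ, 0 ≤ N ∧
      2 * (4 * (1 + 0 + (t₀ - p₀).2 (t₀ - p₀).1) + 6 * halfSqNorm (t₀ - p₀)) ≤ N ^ 2 := by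
    refine ⟨√|2 * (4 * (1 + 0 + (t₀ - p₀).2 (t₀ - p₀).1) + 6 * halfSqNorm (t₀ - p₀))|,
      Real.sqrt_nonneg _, ?_⟩
    rw [Real.sq_sqrt (abs_nonneg _)]
    exact le_abs_self _
  -- Moving `p` by `8σ` into `G` gives a final value of at most `129σ² + 32σN`.
  obtain ⟨σ, hσ, hσ1, hσε⟩ : ∃ σ : ℝ, 0 < σ ∧ σ ≤ 1 ∧ σ * (200 + 32 * N) ≤ ε := by
    refine ⟨min 1 (ε / (200 + 32 * N)), by positivity, min_le_left _ _, ?_⟩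
    rw [← le_div_iff₀ (by positivity)]
    exact min_le_right _ _
  have hσ2 : σ ^ 2 ≤ σ := by nlinarith
  obtain ⟨p, hp⟩ := hG.exists_forall_le hmono p₀ (show 0 < σ ^ 2 by positivity)
  have hpN : ‖p - p₀‖ ≤ N := by
    have h1 := hG.halfSqNorm_sub_le hp (r := t₀) (c := 0)
      fun t ht => by simpa using hmono t₀ ht₀ t ht
    have h2 := norm_sq_le_two_mul_halfSqNorm (p - p₀)
    exact le_of_sq_le_sq (by linarith) hN0
  obtain ⟨q, hq, hqp⟩ := hG.exists_mem_norm_sub_le hmono hmax hσ (p := p) fun t ht => by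
    have := hp t ht
    have := apply_add_halfSqNorm_nonneg (p - p₀)
    linarith
  refine ⟨q, hq, ?_⟩
  have hmin : (p - p₀).2 (p - p₀).1 + halfSqNorm (p - p₀) ≤ σ ^ 2 := by
    refine le_of_forall_pos_le_add fun δ hδ => ?_
    obtain ⟨t, ht, hlt⟩ := hG.exists_apply_sub_lt p hδ
    have := hp t ht
    linarith
  obtain ⟨a, ha⟩ : ∃ a, a = p - p₀ := ⟨_, rfl⟩
  obtain ⟨b, hb⟩ : ∃ b, b = q - p := ⟨_, rfl⟩
  have hab : q - p₀ = a + b := by rw [ha, hb]; abel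
  rw [← ha] at hmin hpN
  rw [← hb] at hqp
  rw [hab]
  have ha1 : ‖a.1‖ ≤ N := (norm_fst_le a).trans hpN
  have ha2 : ‖a.2‖ ≤ N := (norm_snd_le a).trans hpN
  have hb1 : ‖b.1‖ ≤ 8 * σ := (norm_fst_le b).trans hqp
  have hb2 : ‖b.2‖ ≤ 8 * σ := (norm_snd_le b).trans hqp
  have sq_le {V : Type _} [NormedAddCommGroup V] {v w : V} (hv : ‖v‖ ≤ N) (hw : ‖w‖ ≤ 8 * σ) :
      ‖v + w‖ ^ 2 ≤ ‖v‖ ^ 2 + 16 * σ * N + 64 * σ ^ 2 := by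
    have h : ‖v + w‖ ^ 2 ≤ (‖v‖ + 8 * σ) ^ 2 := by
      gcongr
      exact (norm_add_le v w).trans (by linarith)
    nlinarith
  have hm {f : StrongDual ℝ X} {v : X} {A B : ℝ} (hf : ‖f‖ ≤ A) (hv : ‖v‖ ≤ B) : f v ≤ A * B :=
    (apply_le_mul_norm f v).trans
      (mul_le_mul hf hv (norm_nonneg _) ((norm_nonneg _).trans hf))
  have h1 := sq_le ha1 hb1
  have h2 := sq_le ha2 hb2
  have h3 := hm ha2 hb1
  have h4 := hm hb2 ha1
  have h5 := hm hb2 hb1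
  simp only [halfSqNorm, Prod.fst_add, Prod.snd_add, map_add, add_apply]
    at hmin ⊢
  nlinarith

end NegativeInfimum

/-! ### Operators of type (D) and the inclusion -/

section TypeD

universe u

variable {X : Type u} [NormedAddCommGroup X] [NormedSpace ℝ X]

/-- A violating point lies in the extension; along its bounded net the pairing is at most a constant
times `‖zs - ys a‖`, which tends to `0`. -/
lemma IsTypeD.hasNegativeInfimum {T : X → Set (StrongDual ℝ X)} (hD : IsTypeD T) :
    HasNegativeInfimum {t : X × StrongDual ℝ X | t.2 ∈ T t.1} := by
  intro zss zs η hη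
  by_contra! hcon
  obtain ⟨ι, _, _, _, y, ys, hT, hb, -, hys⟩ := hD zss zs
    fun y ys h => hη.le.trans (hcon (y, ys) h)
  obtain ⟨C, hC⟩ := hb.exists_norm_le
  have hlim : Tendsto (fun a => (‖zss‖ + C) * ‖zs - ys a‖) atTop (𝓝 0) := by
    simpa using (hys.const_sub zs).norm.const_mul (‖zss‖ + C)
  obtain ⟨a, ha⟩ := (hlim.eventually_lt_const hη).exists
  have h1 := hcon (y a, ys a) (hT a)
  have h2 := apply_le_mul_norm (zss - NormedSpace.inclusionInDoubleDual ℝ X (y a)) (zs - ys a)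
  have h3 : ‖zss - NormedSpace.inclusionInDoubleDual ℝ X (y a)‖ ≤ ‖zss‖ + C := by
    refine (norm_sub_le zss (NormedSpace.inclusionInDoubleDual ℝ X (y a))).trans ?_
    gcongr
    have h5 : ‖(y a, ys a)‖ ≤ C := hC _ ⟨a, rfl⟩
    exact (NormedSpace.double_dual_bound ℝ X (y a)).trans ((norm_fst_le (y a, ys a)).trans h5)
  have h4 := mul_le_mul_of_nonneg_right h3 (norm_nonneg (zs - ys a))
  linarith

lemma IsMaximalMonotone.mem_of_forall_nonneg {T : X → Set (StrongDual ℝ X)}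
    (hT : IsMaximalMonotone T) {x : X} {xs : StrongDual ℝ X}
    (h : ∀ y, ∀ ys ∈ T y, 0 ≤ (xs - ys) (x - y)) : xs ∈ T x := by
  let T' : X → Set (StrongDual ℝ X) := fun y => T y ∪ {ys | y = x ∧ ys = xs}
  have hT' : IsMonotoneOperator T' := by
    rintro y z ys (hy | ⟨rfl, rfl⟩) zs (hz | ⟨rfl, rfl⟩)
    · exact hT.1 y z ys hy zs hz
    · have := h y ys hy
      simp only [map_sub, sub_apply] at this ⊢
      linarith
    · exact h z zs hz
    · simp
  exact hT.2 hT' (fun y => Set.subset_union_left) x (Or.inr ⟨rfl, rfl⟩)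

lemma mem_add_epsDualityMap_iff {T : X → Set (StrongDual ℝ X)} {ε : ℝ} {x z : X}
    {xs : StrongDual ℝ X} :
    xs ∈ T z + epsDualityMap ε (z - x) ↔
      ∃ zs ∈ T z, (zs - xs) (z - x) + (1 / 2 * ‖z - x‖ ^ 2 + 1 / 2 * ‖zs - xs‖ ^ 2) ≤ ε := by
  have key : ∀ zs, (zs - xs) (z - x) + (1 / 2 * ‖z - x‖ ^ 2 + 1 / 2 * ‖zs - xs‖ ^ 2) ≤ ε ↔
      xs - zs ∈ epsDualityMap ε (z - x) := by
    intro zs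
    rw [mem_epsDualityMap_iff, norm_sub_rev xs zs, ← neg_sub zs xs, neg_apply]
    constructor <;> intro h <;> linarith
  simp only [key]
  constructor
  · rintro ⟨zs, hzs, w, hw, rfl⟩
    exact ⟨zs, hzs, by simpa using hw⟩
  · rintro ⟨zs, hzs, hw⟩
    exact ⟨zs, hzs, _, hw, by simp⟩

lemma IsTypeD.exists_mem_add_epsDualityMap [CompleteSpace X] {T : X → Set (StrongDual ℝ X)}
    (hD : IsTypeD T) (hT : IsMaximalMonotone T) {ε : ℝ} (hε : 0 < ε) (x : X)
    (xs : StrongDual ℝ X) : ∃ z, xs ∈ T z + epsDualityMap ε (z - x) := by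
  obtain ⟨q, hq, h⟩ := hD.hasNegativeInfimum.exists_mem_apply_add_halfSqNorm_le
    (fun s hs t ht => hT.1 s.1 t.1 s.2 hs t.2 ht)
    (fun p hp => hT.mem_of_forall_nonneg fun y ys hy => hp (y, ys) hy) (x, xs) hε
  exact ⟨q.1, mem_add_epsDualityMap_iff.2 ⟨q.2, hq, h⟩⟩

end TypeD

theorem proposition3p2 {X : Type*} [NormedAddCommGroup X] [NormedSpace ℝ X] [CompleteSpace X]
    (T : ℕ → X → Set (StrongDual ℝ X))
    (hT : ∀ n, IsMaximalMonotone (T n)) (hD : ∀ n, IsTypeD (T n))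
    (ε : ℕ → ℝ) (hε : ∀ n, 0 < ε n) (hε0 : Tendsto ε atTop (𝓝 0))
    (x : X) (xs : StrongDual ℝ X) :
    (∀ n, ∃ z : X, xs ∈ T n z + epsDualityMap (ε n) (z - x)) ∧
    ∀ z : ℕ → X, (∀ n, xs ∈ T n (z n) + epsDualityMap (ε n) (z n - x)) →
      (xs ∈ seqLowerLimit T x ↔ Tendsto z atTop (𝓝 x)) := by
  refine ⟨fun n => (hD n).exists_mem_add_epsDualityMap (hT n) (hε n) x xs, fun z hz => ?_⟩
  choose zs hzs h using fun n => mem_add_epsDualityMap_iff.1 (hz n)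
  constructor
  · rintro ⟨y, ys, hy, hlim⟩
    have hu : Tendsto (fun n => ‖y n - x‖) atTop (𝓝 0) :=
      tendsto_iff_norm_sub_tendsto_zero.1 hlim.fst_nhds
    have hv : Tendsto (fun n => ‖ys n - xs‖) atTop (𝓝 0) :=
      tendsto_iff_norm_sub_tendsto_zero.1 hlim.snd_nhds
    have hsq : Tendsto (fun n => ‖z n - x‖ ^ 2) atTop (𝓝 0) := by
      refine squeeze_zero (fun n => sq_nonneg _) (fun n => ?_)
        (show Tendsto (fun n => 4 * (2 * ‖y n - x‖ ^ 2 + 2 * ‖ys n - xs‖ ^ 2 + ε n)) atTop (𝓝 0) by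
          simpa using ((((hu.pow 2).const_mul 2).add ((hv.pow 2).const_mul 2)).add hε0).const_mul 4)
      have hm := (hT n).1 (z n) (y n) (zs n) (hzs n) (ys n) (hy n)
      have h0 := h n
      have e : (zs n - ys n) (z n - y n) = (zs n - xs) (z n - x) - (zs n - xs) (y n - x)
          - (ys n - xs) (z n - x) + (ys n - xs) (y n - x) := by
        simp only [map_sub, sub_apply]; ring
      have h1 := neg_mul_norm_le_apply (zs n - xs) (y n - x)
      have h2 := neg_mul_norm_le_apply (ys n - xs) (z n - x)
      have h3 := apply_le_mul_norm (ys n - xs) (y n - x)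
      -- Young's inequality absorbs `‖zs n - xs‖²` and half of the `½‖z n - x‖²` term; the remaining
      -- quarter accounts for the factor `4`.
      nlinarith [sq_nonneg (‖zs n - xs‖ - 2 * ‖y n - x‖), sq_nonneg (‖z n - x‖ - 2 * ‖ys n - xs‖),
        sq_nonneg (‖y n - x‖ - ‖ys n - xs‖), sq_nonneg ‖zs n - xs‖, sq_nonneg ‖y n - x‖,
        sq_nonneg ‖ys n - xs‖]
    refine tendsto_iff_norm_sub_tendsto_zero.2 ?_
    simpa [Real.sqrt_sq] using hsq.sqrt
  · intro hlim
    refine ⟨z, zs, hzs, hlim.prodMk_nhds (tendsto_iff_norm_sub_tendsto_zero.2 ?_)⟩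
    have ha := tendsto_iff_norm_sub_tendsto_zero.1 hlim
    have hr : Tendsto (fun n => ‖z n - x‖ + √(2 * ε n)) atTop (𝓝 0) := by
      simpa using ha.add (hε0.const_mul 2).sqrt
    refine squeeze_zero (fun n => norm_nonneg _) (fun n => ?_) hr
    have h1 := neg_mul_norm_le_apply (zs n - xs) (z n - x)
    have h2 : ‖zs n - xs‖ - ‖z n - x‖ ≤ √(2 * ε n) :=
      Real.le_sqrt_of_sq_le (by nlinarith [h n])
    linarith
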